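/- Notation. For real $a$ let $\lfloor a\rceil!=\Gamma(a+1)$ if $a$ is not a negative integer and $\lfloor a\rceil!=(-1)^{a+1}/(-a-1)!$ if it is. For a finitely supported exponent vector $\alpha=(\alpha_1,\alpha_2,\dots)$ of real numbers put $\ell^{\alpha}=(\log x)^{\alpha_1}(\log\log x)^{\alpha_2}\cdots$, and let $$\lambda_a^{\alpha}(x)=\lfloor a\rceil!\,x^{a}\sum_{k\ge 0}s_k(a)\Big(x\frac{d}{dx}\Big)^{k}\ell^{\alpha},\qquad \sum_{k\ge0}s_k(a)y^k=\frac{\Gamma(1+y)}{\Gamma(1+y+a)},$$ be the harmonic logarithm of degree $a$ and order $\alpha$ (so $\lambda_0^\alpha=\ell^\alpha$). For $\alpha\ne(0)$ let $\mathcal I^{\alpha}$ be the space of formal series $\sum_a c_a\lambda_a^{\alpha}(x)$, $a\in\mathbb R$, $c_a\in\mathbb C$, whose support contains no infinite strictly increasing sequence, and let $\langle\sum_a c_a\lambda_a^\alpha\rangle_\alpha=c_0$. Artinian operators are formal series $f(D)=\sum_b f_bD^b$, $b\in\mathbb R$, $f_b\in\mathbb C$, with well-ordered support; they act on $\mathcal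 I^\alpha$ through $D^b\lambda_a^\alpha=\frac{\lfloor a\rceil!}{\lfloor a-b\rceil!}\lambda_{a-b}^\alpha$. Put $f'(D)=\sum_b bf_bD^{b-1}$. A delta operator is an Artinian operator of degree one, i.e. $f(D)=cD(1+h(D))$ with $c\ne0$ and all exponents of $h$ positive; for $b\in\mathbb R$ and $n\in\mathbb Z$ its $n$-th exponentiation is $$f(D)^{b;n}=e^{b(\log c+2\pi i n)}D^{b}\sum_{k\ge0}\binom bk h(D)^k ,$$ with $\log$ the principal branch. Proposition. Let $f(D)$ be a delta operator and let $\alpha\neq(0)$. (Discrete case) Suppose that only integer powers of $D$ occur in $f(D)$, and let $(p_a^\alpha(x))_{a\in\mathbb Z}$ be the order $\alpha$ part of the associated graded sequence of $f(D)$: every $p_a^\alpha$ is a series in $\mathcal I^\alpha$ that involves only $\lambda_b^\alpha$ with $b\in\mathbb Z$, and $\langle f(D)^{b}p_a^\alpha(x)\rangle_\alpha=\lfloor a\rceil!\,\delta_{ab}$ for all $a,b\in\mathbb Z$. Then for all $a\in\mathbb Z$ $$p_a^{\alpha}(x)=\lfloor a\rceil!\,f'(D)f(D)^{-1-a}\lambda_{-1}^{\alpha}(x).$$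 (Continuous case) Let $n\in\mathbb Z$ and let $(p_a^\alpha(x))_{a\in\mathbb R}$ be the order $\alpha$ part of the $n$-th associated graded sequence of $f(D)$: $p_a^\alpha\in\mathcal I^\alpha$ and $\langle f(D)^{b;n}p_a^\alpha(x)\rangle_\alpha=\lfloor a\rceil!\,\delta_{ab}$ for all $a,b\in\mathbb R$. Then for all $a\in\mathbb R$ $$p_a^{\alpha}(x)=\lfloor a\rceil!\,f'(D)f(D)^{-1-a;n}\lambda_{-1}^{\alpha}(x).$$ -/

import Mathlib

noncomputable section

namespace LogAlgebra

/-! ### Roman factorials -/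

/-- The Roman factorial `⌊a⌉!` of a real number: `(-1) ^ (a + 1) / (-a - 1)!` when `a` is a negative
integer `a = -(m + 1)`, and `Γ (a + 1)` otherwise. -/
def romanFactorial (a : ℝ) : ℝ :=
  open Classical in
  if ∃ m : ℕ, a = -((m : ℝ) + 1) then (-1) ^ ⌊-a - 1⌋₊ / (Nat.factorial ⌊-a - 1⌋₊ : ℝ)
  else Real.Gamma (a + 1)

theorem romanFactorial_ne_zero (a : ℝ) : romanFactorial a ≠ 0 := by
  unfold romanFactorial
  split_ifs with h
  · positivity
  · refine Real.Gamma_ne_zero fun m hm => h ⟨m, by linarith⟩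

/-! ### Logarithmic monomials and logarithmic series -/

/-- The exponent vector `α` of the iterated logarithms: `α i` is the exponent of the `(i + 1)`-fold
iterated logarithm, so `α` stands for `ℓ ^ α = (log x) ^ (α 0) * (log log x) ^ (α 1) * ⋯`. -/
abbrev LogOrder : Type := ℕ →₀ ℝ

/-- Formal series `∑ c_β ℓ ^ β` in the iterated logarithms whose support satisfies the ascending
chain condition in the lexicographic order (the order of growth at infinity). -/
abbrev LogCoeff : Type := HahnSeries (Lex LogOrder)ᵒᵈ ℂ

/-- Formal series of logarithmic type: series `∑ c_{a, β} x ^ a ℓ ^ β` satisfying the ascending chain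
condition, written as series in `x` whose coefficients are series in the iterated logarithms. -/
abbrev LogSeries : Type := HahnSeries ℝᵒᵈ LogCoeff

/-- The vector `(1, …, 1, 0, …)` with `i + 1` ones. -/
def onesVec (i : ℕ) : LogOrder := ∑ j ∈ Finset.range (i + 1), Finsupp.single j 1

/-- The derivation `x d/dx` on finite combinations of the monomials `ℓ ^ α`:
`x d/dx ℓ ^ α = ∑ i, α i * ℓ ^ (α - (1, …, 1, 0, …))` with `i + 1` ones. -/
def logEuler : (LogOrder →₀ ℂ) →ₗ[ℂ] (LogOrder →₀ ℂ) :=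
  Finsupp.linearCombination ℂ fun α : LogOrder =>
    ∑ i ∈ α.support, Finsupp.single (α - onesVec i) (α i : ℂ)

/-- The coefficient of `y ^ k` in the Taylor series at `0` of the function
`Γ (1 + y) / Γ (1 + y + a)` (a generalized Stirling number of the first kind `s(-a, k)`). The
reciprocal Gamma function is entire, with value `0` at the poles of `Γ`. -/
def stirlingCoeff (a : ℝ) (k : ℕ) : ℂ :=
  iteratedDeriv k (fun y : ℂ => Complex.Gamma (1 + y) * (Complex.Gamma (1 + y + a))⁻¹) 0
    / (Nat.factorial k : ℂ)

theorem onesVec_zero (i : ℕ) : onesVec i 0 = 1 := by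
  simp [onesVec, Finsupp.finsetSum_apply, Finsupp.single_apply]

theorem logEuler_pow_coeff (α β : LogOrder) (k : ℕ)
    (h : ((logEuler ^ k) (Finsupp.single α 1)) β ≠ 0) : β 0 = α 0 - k := by
  induction k generalizing β with
  | zero =>
    have : β = α := by
      by_contra hne
      exact h (by simp [Ne.symm hne])
    simp [this]
  | succ k ih =>
    rw [pow_succ', Module.End.mul_apply] at h
    set u := (logEuler ^ k) (Finsupp.single α 1) with hu
    rw [logEuler, Finsupp.linearCombination_apply, Finsupp.sum, Finsupp.finsetSum_apply] at h
    obtain ⟨γ, hγ, h1⟩ := Finset.exists_ne_zero_of_sum_ne_zero h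
    have h2 := ih γ (Finsupp.mem_support_iff.1 hγ)
    rw [Finsupp.smul_apply, Finsupp.finsetSum_apply] at h1
    have h3 := right_ne_zero_of_smul h1
    obtain ⟨i, -, h4⟩ := Finset.exists_ne_zero_of_sum_ne_zero h3
    have h5 : γ - onesVec i = β := by
      by_contra hne
      exact h4 (by simp [hne])
    rw [← h5, Finsupp.sub_apply, h2, onesVec_zero]
    push_cast
    ring

theorem le_zero_of_lex_le {β γ : LogOrder} (h : toLex β ≤ toLex γ) : β 0 ≤ γ 0 := by
  rcases h.lt_or_eq with h | h
  · obtain ⟨i, hi, hlt⟩ := Finsupp.Lex.lt_iff.1 h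
    rcases Nat.eq_zero_or_pos i with rfl | hpos
    · exact le_of_lt hlt
    · exact le_of_eq (hi 0 hpos)
  · rw [toLex_inj.1 h]

/-- The series `∑ k, s(-a, k) (x d/dx) ^ k ℓ ^ α`, multiplied by `⌊a⌉!`: the coefficient of `x ^ a` in
the harmonic logarithm of degree `a` and order `α`. The coefficient of each `ℓ ^ β` receives a
contribution from at most one `k`. -/
def harmonicCoeff (a : ℝ) (α : LogOrder) : LogCoeff where
  coeff β := (romanFactorial a : ℂ) *
    ∑ᶠ k : ℕ, stirlingCoeff a k *
      ((logEuler ^ k) (Finsupp.single α 1)) (ofLex (OrderDual.ofDual β))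
  isPWO_support' := by
    have key : ∀ β : (Lex LogOrder)ᵒᵈ, (romanFactorial a : ℂ) *
        (∑ᶠ k : ℕ, stirlingCoeff a k *
          ((logEuler ^ k) (Finsupp.single α 1)) (ofLex (OrderDual.ofDual β))) ≠ 0 →
        ∃ k : ℕ, ((logEuler ^ k) (Finsupp.single α 1)) (ofLex (OrderDual.ofDual β)) ≠ 0 := by
      intro β hβ
      by_contra! hc
      exact hβ (by simp [hc])
    rw [Set.IsPWO, Set.partiallyWellOrderedOn_iff_exists_lt]
    intro f hf
    choose κ hκ using fun n => key (f n) (hf n)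
    by_cases hex : ∃ n, 0 < n ∧ f 0 ≤ f n
    · obtain ⟨n, hn, hle⟩ := hex
      exact ⟨0, n, hn, hle⟩
    · push Not at hex
      have hle : ∀ n, κ n ≤ κ 0 := by
        intro n
        rcases Nat.eq_zero_or_pos n with rfl | hn
        · exact le_rfl
        have h1 : toLex (ofLex (OrderDual.ofDual (f 0))) ≤ toLex (ofLex (OrderDual.ofDual (f n))) :=
          le_of_lt (hex n hn)
        have h2 := le_zero_of_lex_le h1
        rw [logEuler_pow_coeff _ _ _ (hκ 0), logEuler_pow_coeff _ _ _ (hκ n)] at h2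
        have h3 : (κ n : ℝ) ≤ κ 0 := by linarith
        exact_mod_cast h3
      let F : Finset LogOrder :=
        (Finset.range (κ 0 + 1)).biUnion fun k => ((logEuler ^ k) (Finsupp.single α 1)).support
      have hF : ∀ n, ofLex (OrderDual.ofDual (f n)) ∈ F := fun n =>
        Finset.mem_biUnion.2 ⟨κ n, Finset.mem_range.2 (Nat.lt_succ_of_le (hle n)),
          Finsupp.mem_support_iff.2 (hκ n)⟩
      obtain ⟨m, n, hmn, heq⟩ := Finite.exists_ne_map_eq_of_infinite
        (fun n : ℕ => (⟨ofLex (OrderDual.ofDual (f n)), hF n⟩ : F))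
      have heq' : f m = f n := congrArg Subtype.val heq
      rcases lt_or_gt_of_ne hmn with h | h
      · exact ⟨m, n, h, heq'.le⟩
      · exact ⟨n, m, h, heq'.ge⟩

/-- The harmonic logarithm `λ_a^α(x) = ⌊a⌉! x ^ a ∑ k, s(-a, k) (x d/dx) ^ k ℓ ^ α`. In particular
`λ_0^α = ℓ ^ α`, and `d/dx λ_a^α = ⌊a⌉!/⌊a-1⌉! λ_{a-1}^α` because `(a + y) / Γ (1 + y + a)` equals
`1 / Γ (y + a)`. -/
def harmonicLog (α : LogOrder) (a : ℝ) : LogSeries :=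
  HahnSeries.single (OrderDual.toDual a) (harmonicCoeff a α)

/-! ### The subspace of series of order `α` -/

/-- The series `∑ a, c_a λ_a^α(x)` with given coefficients `c`, whose support satisfies the ascending
chain condition; `c_a λ_a^α` is the only term that contributes to the coefficient of `x ^ a`. -/
def expand (α : LogOrder) : HahnSeries ℝᵒᵈ ℂ →ₗ[ℂ] LogSeries where
  toFun c :=
    { coeff := fun a => c.coeff a • harmonicCoeff (OrderDual.ofDual a) α
      isPWO_support' := c.isPWO_support.mono fun a ha h => ha (by
        simp only [h]
        exact zero_smul ℂ (harmonicCoeff (OrderDual.ofDual a) α)) }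
  map_add' c d := by ext1; funext a; exact add_smul (c.coeff a) (d.coeff a) (harmonicCoeff _ α)
  map_smul' r c := by ext1; funext a; exact mul_smul r (c.coeff a) (harmonicCoeff _ α)

theorem expand_single (α : LogOrder) (a : ℝ) :
    expand α (HahnSeries.single (OrderDual.toDual a) 1) = harmonicLog α a := by
  ext1
  funext b
  by_cases h : b = OrderDual.toDual a
  · rw [h]
    change (HahnSeries.single (OrderDual.toDual a) (1 : ℂ)).coeff (OrderDual.toDual a) •
      harmonicCoeff a α = _
    rw [harmonicLog, HahnSeries.coeff_single_same, HahnSeries.coeff_single_same]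
    exact one_smul ℂ (harmonicCoeff a α)
  · change (HahnSeries.single (OrderDual.toDual a) (1 : ℂ)).coeff b •
      harmonicCoeff (OrderDual.ofDual b) α = _
    rw [harmonicLog, HahnSeries.coeff_single_of_ne h, HahnSeries.coeff_single_of_ne h]
    exact zero_smul ℂ (harmonicCoeff (OrderDual.ofDual b) α)

theorem coeff_harmonicCoeff (a : ℝ) (α β : LogOrder) (k : ℕ) (hk : β 0 = α 0 - k) :
    (harmonicCoeff a α).coeff (OrderDual.toDual (toLex β)) =
      (romanFactorial a : ℂ) * (stirlingCoeff a k * ((logEuler ^ k) (Finsupp.single α 1)) β) := by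
  change (romanFactorial a : ℂ) * (∑ᶠ k : ℕ, stirlingCoeff a k *
    ((logEuler ^ k) (Finsupp.single α 1)) β) = _
  congr 1
  refine finsum_eq_single _ k fun m hm => ?_
  by_contra hne
  have h := logEuler_pow_coeff α β m (right_ne_zero_of_mul hne)
  rw [hk] at h
  exact hm (by exact_mod_cast (show (m : ℝ) = k by linarith))

theorem deriv_inv_Gamma_neg_nat (m : ℕ) :
    deriv (fun s : ℂ => (Complex.Gamma s)⁻¹) (-(m : ℂ)) ≠ 0 := by
  have hd : Differentiable ℂ fun s : ℂ => (Complex.Gamma s)⁻¹ :=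
    Complex.differentiable_one_div_Gamma
  have hrec : ∀ s : ℂ, deriv (fun s : ℂ => (Complex.Gamma s)⁻¹) s =
      (Complex.Gamma (s + 1))⁻¹ + s * deriv (fun s : ℂ => (Complex.Gamma s)⁻¹) (s + 1) := by
    intro s
    have h1 : HasDerivAt (fun s : ℂ => (Complex.Gamma (s + 1))⁻¹)
        (deriv (fun s : ℂ => (Complex.Gamma s)⁻¹) (s + 1)) s := by
      have := (hd (s + 1)).hasDerivAt.comp_add_const s 1
      simpa using this
    have h2 := (hasDerivAt_id s).mul h1
    have h3 : (fun s : ℂ => (Complex.Gamma s)⁻¹) =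
        (id * fun s : ℂ => (Complex.Gamma (s + 1))⁻¹) := by
      funext s
      simpa using Complex.one_div_Gamma_eq_self_mul_one_div_Gamma_add_one s
    have h4 := h2.deriv
    rw [← h3] at h4
    rw [h4]
    simp
  induction m with
  | zero =>
    rw [hrec]
    simp
  | succ m ih =>
    rw [hrec]
    have e : (-((m + 1 : ℕ) : ℂ) + 1) = -(m : ℂ) := by push_cast; ring
    rw [e, Complex.Gamma_neg_nat_eq_zero, inv_zero, zero_add]
    refine mul_ne_zero ?_ ih
    exact neg_ne_zero.2 (Nat.cast_ne_zero.2 (Nat.succ_ne_zero m))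

theorem stirlingCoeff_one_ne_zero (m : ℕ) : stirlingCoeff (-((m : ℝ) + 1)) 1 ≠ 0 := by
  have hd : Differentiable ℂ fun s : ℂ => (Complex.Gamma s)⁻¹ :=
    Complex.differentiable_one_div_Gamma
  have hG : DifferentiableAt ℂ (fun y : ℂ => Complex.Gamma (1 + y)) 0 := by
    have h := Complex.differentiableAt_Gamma (1 + 0) (fun k hk => by
      have := congrArg Complex.re hk
      simp at this
      have h0 : (0 : ℝ) ≤ k := Nat.cast_nonneg k
      linarith)
    exact DifferentiableAt.comp (0 : ℂ) h ((differentiableAt_const _).add differentiableAt_id)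
  have e : ((1 : ℂ) + ((-((m : ℝ) + 1) : ℝ) : ℂ)) = -(m : ℂ) := by push_cast; ring
  have h1 : HasDerivAt (fun y : ℂ => (Complex.Gamma (1 + y + ((-((m : ℝ) + 1) : ℝ) : ℂ)))⁻¹)
      (deriv (fun s : ℂ => (Complex.Gamma s)⁻¹) (-(m : ℂ))) 0 := by
    have h2 : HasDerivAt (fun s : ℂ => (Complex.Gamma s)⁻¹)
        (deriv (fun s : ℂ => (Complex.Gamma s)⁻¹) (-(m : ℂ))) (0 + -(m : ℂ)) := by
      rw [zero_add]; exact (hd _).hasDerivAt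
    have h3 := h2.comp_add_const (0 : ℂ) (-(m : ℂ))
    refine h3.congr_of_eventuallyEq (Filter.Eventually.of_forall fun y => ?_)
    simp only
    rw [← e]
    ring_nf
  have h5 := (hG.hasDerivAt.mul h1).deriv
  rw [stirlingCoeff, iteratedDeriv_one]
  change deriv ((fun y : ℂ => Complex.Gamma (1 + y)) *
    fun y : ℂ => (Complex.Gamma (1 + y + ((-((m : ℝ) + 1) : ℝ) : ℂ)))⁻¹) 0 / _ ≠ 0
  rw [h5, add_zero, e, Complex.Gamma_neg_nat_eq_zero]
  simpa using deriv_inv_Gamma_neg_nat m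

theorem harmonicCoeff_ne_zero (a : ℝ) {α : LogOrder} (hα : α ≠ 0) : harmonicCoeff a α ≠ 0 := by
  intro h
  have hr : (romanFactorial a : ℂ) ≠ 0 := by exact_mod_cast romanFactorial_ne_zero a
  by_cases ha : ∃ m : ℕ, a = -((m : ℝ) + 1)
  · obtain ⟨m, rfl⟩ := ha
    obtain ⟨i, hi⟩ := Finsupp.ne_iff.1 hα
    have hi : α i ≠ 0 := hi
    have hc := coeff_harmonicCoeff (-((m : ℝ) + 1)) α (α - onesVec i) 1
      (by simp [onesVec_zero])
    rw [h, HahnSeries.coeff_zero, pow_one, logEuler, Finsupp.linearCombination_single, one_smul,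
      Finsupp.finsetSum_apply, Finset.sum_eq_single_of_mem i (Finsupp.mem_support_iff.2 hi)] at hc
    · have := mul_ne_zero hr (mul_ne_zero (stirlingCoeff_one_ne_zero m)
        (show (α i : ℂ) ≠ 0 by exact_mod_cast hi))
      exact this (by simpa using hc.symm)
    · intro j _ hj
      rw [Finsupp.single_apply, if_neg]
      intro he
      have he' : onesVec j = onesVec i := by simpa using he
      have key : ∀ i j : ℕ, onesVec i j = if j ≤ i then (1 : ℝ) else 0 := by
        intro i j
        simp [onesVec, Finsupp.finsetSum_apply, Finsupp.single_apply]
      have hji := DFunLike.congr_fun he' j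
      have hij := DFunLike.congr_fun he' i
      simp only [key, le_refl, if_true] at hji hij
      have h1 : j ≤ i := by by_contra hc; simp [hc] at hji
      have h2 : i ≤ j := by by_contra hc; simp [hc] at hij
      exact hj (le_antisymm h1 h2)
  · have hc := coeff_harmonicCoeff a α α 0 (by simp)
    rw [h, HahnSeries.coeff_zero] at hc
    have hG : Complex.Gamma (1 + (a : ℂ)) ≠ 0 := by
      refine Complex.Gamma_ne_zero fun m hm => ha ⟨m, ?_⟩
      have := congrArg Complex.re hm
      simp at this
      linarith
    have : stirlingCoeff a 0 ≠ 0 := by simpa [stirlingCoeff] using hG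
    exact mul_ne_zero hr (mul_ne_zero this one_ne_zero) (by simpa using hc.symm)

theorem expand_injective {α : LogOrder} (hα : α ≠ 0) : Function.Injective (expand α) := by
  refine (injective_iff_map_eq_zero (expand α)).2 fun c hc => ?_
  ext a
  have h : c.coeff a • harmonicCoeff (OrderDual.ofDual a) α = 0 :=
    congrArg (fun p : LogSeries => p.coeff a) hc
  by_contra hne
  refine harmonicCoeff_ne_zero (OrderDual.ofDual a) hα ?_
  have h2 := congrArg (fun q : LogCoeff => (c.coeff a)⁻¹ • q) h
  have h3 : (c.coeff a)⁻¹ • c.coeff a • harmonicCoeff (OrderDual.ofDual a) α =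
      harmonicCoeff (OrderDual.ofDual a) α := inv_smul_smul₀ hne _
  rw [← h3]
  exact h2.trans (smul_zero (A := LogCoeff) (c.coeff a)⁻¹)

/-- The space `I^α` of formal series of logarithmic type of order `α`. -/
abbrev orderSpace (α : LogOrder) : Submodule ℂ LogSeries := LinearMap.range (expand α)

/-- For `α ≠ 0`, the coefficients of a series of order `α` in the harmonic logarithms `λ_a^α`. -/
def coords {α : LogOrder} (hα : α ≠ 0) : orderSpace α ≃ₗ[ℂ] HahnSeries ℝᵒᵈ ℂ :=
  (LinearEquiv.ofInjective (expand α) (expand_injective hα)).symm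

/-- The harmonic logarithm `λ_a^α` as an element of `I^α`. -/
def harmonic (α : LogOrder) (a : ℝ) : orderSpace α :=
  ⟨harmonicLog α a, _, expand_single α a⟩

theorem coords_harmonic {α : LogOrder} (hα : α ≠ 0) (a : ℝ) :
    coords hα (harmonic α a) = HahnSeries.single (OrderDual.toDual a) 1 := by
  rw [coords, LinearEquiv.symm_apply_eq]
  exact Subtype.ext (expand_single α a).symm

/-- The augmentation `⟨p⟩_α`: the coefficient of `λ_0^α` in `p`. -/
def augmentation {α : LogOrder} (hα : α ≠ 0) (p : orderSpace α) : ℂ :=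
  (coords hα p).coeff (OrderDual.toDual 0)

/-! ### Artinian operators -/

/-- Artinian operators `f(D) = ∑ b, f_b D ^ b`: real exponents `b`, complex coefficients, and a
support that satisfies the descending chain condition. -/
abbrev ArtinianOp : Type := HahnSeries ℝ ℂ

/-- `∑ a, c_a λ_a^α` written as `∑ b, h_b D ^ b` applied to `λ_0^α`, that is, in the basis
`D ^ b λ_0^α = λ_{-b}^α / ⌊-b⌉!`. -/
def toOperator (c : HahnSeries ℝᵒᵈ ℂ) : ArtinianOp where
  coeff b := (romanFactorial (-b) : ℂ) * c.coeff (OrderDual.toDual (-b))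
  isPWO_support' := by
    refine (HahnSeries.embDomain (OrderIso.neg ℝ).symm.toOrderEmbedding c).isPWO_support.mono
      fun b hb hz => hb ?_
    have h := HahnSeries.embDomain_coeff (f := (OrderIso.neg ℝ).symm.toOrderEmbedding) (x := c)
      (a := OrderDual.toDual (-b))
    have e : (OrderIso.neg ℝ).symm.toOrderEmbedding (OrderDual.toDual (-b)) = b :=
      neg_neg b
    rw [e, hz] at h
    change (romanFactorial (-b) : ℂ) * c.coeff (OrderDual.toDual (-b)) = 0
    rw [← h, mul_zero]

/-- The inverse of `toOperator`. -/
def ofOperator (h : ArtinianOp) : HahnSeries ℝᵒᵈ ℂ where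
  coeff a := h.coeff (-(OrderDual.ofDual a)) / (romanFactorial (OrderDual.ofDual a) : ℂ)
  isPWO_support' := by
    refine (HahnSeries.embDomain (OrderIso.neg ℝ).toOrderEmbedding h).isPWO_support.mono
      fun a ha hz => ha ?_
    have h' := HahnSeries.embDomain_coeff (f := (OrderIso.neg ℝ).toOrderEmbedding) (x := h)
      (a := -(OrderDual.ofDual a))
    have e : (OrderIso.neg ℝ).toOrderEmbedding (-(OrderDual.ofDual a)) = a := by simp
    rw [e, hz] at h'
    simp [← h']

/-- The action of Artinian operators on `I^α`, `α ≠ 0`: the bilinear extension, with infinite sums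
collected coefficientwise, of `D ^ b λ_a^α = ⌊a⌉! / ⌊a - b⌉! λ_{a-b}^α` (see `act_single`). -/
def act {α : LogOrder} (hα : α ≠ 0) (g : ArtinianOp) (p : orderSpace α) : orderSpace α :=
  (coords hα).symm (ofOperator (g * toOperator (coords hα p)))

theorem act_single {α : LogOrder} (hα : α ≠ 0) (a b : ℝ) :
    act hα (HahnSeries.single b 1) (harmonic α a) =
      ((romanFactorial a : ℂ) / (romanFactorial (a - b) : ℂ)) • harmonic α (a - b) := by
  rw [act, LinearEquiv.symm_apply_eq, map_smul, coords_harmonic, coords_harmonic]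
  have h1 : toOperator (HahnSeries.single (OrderDual.toDual a) 1) =
      HahnSeries.single (-a) (romanFactorial a : ℂ) := by
    ext c
    by_cases hc : c = -a
    · subst hc; simp [toOperator]
    · have : OrderDual.toDual (-c) ≠ OrderDual.toDual a := fun h => hc (by
        have := OrderDual.toDual_inj.1 h
        linarith)
      change (romanFactorial (-c) : ℂ) * HahnSeries.coeff _ (OrderDual.toDual (-c)) = _
      rw [HahnSeries.coeff_single_of_ne hc, HahnSeries.coeff_single_of_ne this, mul_zero]
  rw [h1, HahnSeries.single_mul_single, one_mul]
  ext c
  by_cases hc : c = OrderDual.toDual (a - b)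
  · subst hc
    have : -(a - b) = b + -a := by ring
    simp only [ofOperator, OrderDual.ofDual_toDual, this, HahnSeries.coeff_single_same,
      HahnSeries.coeff_smul, smul_eq_mul, mul_one]
  · have : -(OrderDual.ofDual c) ≠ b + -a := fun h => hc (OrderDual.ofDual_inj.1 (by
      simp only [OrderDual.ofDual_toDual]
      linarith))
    rw [HahnSeries.coeff_smul, HahnSeries.coeff_single_of_ne hc, smul_zero]
    change HahnSeries.coeff _ (-(OrderDual.ofDual c)) / _ = _
    rw [HahnSeries.coeff_single_of_ne this, zero_div]

/-- A delta operator: a (nonzero) Artinian operator of degree one, i.e. the smallest exponent in its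
support is `1`. -/
def IsDelta (f : ArtinianOp) : Prop := f ≠ 0 ∧ f.order = 1

/-- The Pincherle derivative `f'(D)`, given by `D ^ a ↦ a D ^ (a - 1)`. -/
def pincherle (f : ArtinianOp) : ArtinianOp where
  coeff b := ((b : ℂ) + 1) * f.coeff (b + 1)
  isPWO_support' := by
    refine (HahnSeries.single (-1 : ℝ) (1 : ℂ) * f).isPWO_support.mono fun b hb hz => hb ?_
    have h := HahnSeries.coeff_single_mul_add (r := (1 : ℂ)) (x := f) (a := b + 1) (b := (-1 : ℝ))
    have e : b + 1 + -1 = b := by ring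
    rw [e, hz, one_mul] at h
    simp [← h]

/-- The `n`-th exponentiation `f(D) ^ {b;n}` of a nonzero Artinian operator
`f(D) = c D ^ d (1 + h(D))` with `h` of positive degree:
`f(D) ^ {b;n} = c ^ {b;n} D ^ (b d) ∑ k, (b choose k) h(D) ^ k`, where
`c ^ {b;n} = exp (b (log c + 2 π i n))`. -/
def npower (f : ArtinianOp) (n : ℤ) (b : ℝ) : ArtinianOp :=
  HahnSeries.single (b * f.order)
      (Complex.exp ((b : ℂ) * (Complex.log f.leadingCoeff + 2 * Real.pi * Complex.I * n))) *
    (HahnSeries.SummableFamily.binomialFamily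
      (HahnSeries.single (-f.order) (f.leadingCoeff)⁻¹ * f) (b : ℂ)).hsum

/-! ### Associated sequences -/

/-- Continuous case: `p = (p_a^α)`, `a` real, is the order `α` part of the `n`-th associated graded
sequence of `f(D)`: every `p_a` is a series of order `α`, and
`⟨f(D) ^ {b;n} p_a⟩_α = ⌊a⌉! δ_{a b}` for all real `a` and `b`. (It follows that `p_a` has degree
exactly `a`.) -/
def IsAssociated (f : ArtinianOp) (n : ℤ) {α : LogOrder} (hα : α ≠ 0)
    (p : ℝ → orderSpace α) : Prop :=
  ∀ a b : ℝ, augmentation hα (act hα (npower f n b) (p a)) =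
    open Classical in if a = b then (romanFactorial a : ℂ) else 0

/-- The operators of the discrete case: those that involve integer powers of `D` only. -/
def IsDiscreteOp (f : ArtinianOp) : Prop := ∀ b ∈ f.support, ∃ k : ℤ, (k : ℝ) = b

/-- The series of the discrete case: combinations of the `λ_a^α` with integer `a`. -/
def IsDiscreteSeries {α : LogOrder} (hα : α ≠ 0) (p : orderSpace α) : Prop :=
  ∀ a ∈ (coords hα p).support, ∃ k : ℤ, (k : ℝ) = OrderDual.ofDual a

/-- Discrete case: `p = (p_a^α)`, `a` an integer, is the order `α` part of the associated graded
sequence of `f(D)`: `⟨f(D) ^ b p_a⟩_α = ⌊a⌉! δ_{a b}` for all integers `a` and `b`, the powers being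
taken in the field of Artinian operators. -/
def IsAssociatedDiscrete (f : ArtinianOp) {α : LogOrder} (hα : α ≠ 0)
    (p : ℤ → orderSpace α) : Prop :=
  (∀ a : ℤ, IsDiscreteSeries hα (p a)) ∧
  ∀ a b : ℤ, augmentation hα (act hα (f ^ b) (p a)) =
    if a = b then (romanFactorial a : ℂ) else 0

end LogAlgebra

end

noncomputable section

namespace LogAlgebra

open HahnSeries HahnSeries.SummableFamily

/-! ### Series of order `α` as Artinian operators -/

/-! Since `α ≠ 0`, every series of order `α` is `g λ_0^α` for exactly one Artinian operator `g`
(`operatorOf`). In these coordinates the action is multiplication (`operatorOf_act`), the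
augmentation reads off the coefficient of `D ^ 0`, and `λ_{-1}^α` is `D`. The right-hand side of the
formula becomes `⌊a⌉! f ^ (-1 - a) E f`, where `E = D d/dD` and `E f = f' D`.

The claim is then a residue computation, with the coefficient of `D ^ 0` as residue. Pairing with `f
^ b` gives the residue of `f ^ (b - a - 1) E f`. For `b ≠ a` this is `E (f ^ (b - a))` divided by `b
- a`, and the image of `E` has no constant term. For `b = a` it is the logarithmic derivative of
`f`, whose residue is the degree of `f`, namely `1` (`coeff_zero_npower_mul_euler`,
`coeff_zero_zpow_mul_euler`).

So both sides have the same pairings. Their difference `q` vanishes because a nonzero `q` has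
nonzero residue against the power of `f` of opposite degree (`eq_zero_of_coeff_zero_mul`). In the
discrete case only integer powers are available, so the degree of `q` must be shown to be an
integer. -/

theorem toOperator_coeff (c : HahnSeries ℝᵒᵈ ℂ) (b : ℝ) :
    (toOperator c).coeff b = (romanFactorial (-b) : ℂ) * c.coeff (OrderDual.toDual (-b)) := rfl

theorem toOperator_ofOperator (h : ArtinianOp) : toOperator (ofOperator h) = h := by
  ext b
  have hr : (romanFactorial (-b) : ℂ) ≠ 0 := by exact_mod_cast romanFactorial_ne_zero (-b)
  have e : (ofOperator h).coeff (OrderDual.toDual (-b)) =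
      h.coeff (- -b) / (romanFactorial (-b) : ℂ) := rfl
  rw [toOperator_coeff, e, neg_neg, mul_div_cancel₀ _ hr]

theorem toOperator_injective : Function.Injective toOperator := by
  intro c d h
  ext a
  have h1 := congrArg (fun x : ArtinianOp => x.coeff (-(OrderDual.ofDual a))) h
  simp only [toOperator_coeff, neg_neg, OrderDual.toDual_ofDual] at h1
  exact mul_left_cancel₀ (by exact_mod_cast romanFactorial_ne_zero _) h1

/-- The operator `g` with `p = g λ_0^α`. -/
def operatorOf {α : LogOrder} (hα : α ≠ 0) (p : orderSpace α) : ArtinianOp :=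
  toOperator (coords hα p)

theorem operatorOf_injective {α : LogOrder} (hα : α ≠ 0) :
    Function.Injective (operatorOf hα) :=
  toOperator_injective.comp (coords hα).injective

/-- The basis `D ^ b λ_0^α` absorbs the ratios of Roman factorials, which is why the action turns
into plain multiplication in a commutative field. -/
theorem operatorOf_act {α : LogOrder} (hα : α ≠ 0) (g : ArtinianOp) (p : orderSpace α) :
    operatorOf hα (act hα g p) = g * operatorOf hα p := by
  rw [operatorOf, act, LinearEquiv.apply_symm_apply, toOperator_ofOperator, operatorOf]

theorem operatorOf_smul {α : LogOrder} (hα : α ≠ 0) (r : ℂ) (p : orderSpace α) :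
    operatorOf hα (r • p) = r • operatorOf hα p := by
  ext b
  rw [operatorOf, map_smul, toOperator_coeff, HahnSeries.coeff_smul, HahnSeries.coeff_smul,
    operatorOf, toOperator_coeff, smul_eq_mul, smul_eq_mul, mul_left_comm]

theorem romanFactorial_zero : romanFactorial 0 = 1 := by
  rw [romanFactorial, if_neg]
  · simp
  · rintro ⟨m, hm⟩
    have : (0 : ℝ) ≤ m := m.cast_nonneg
    linarith

theorem romanFactorial_neg_one : romanFactorial (-1) = 1 := by
  rw [romanFactorial, if_pos ⟨0, by simp⟩]
  simp

theorem augmentation_eq_coeff {α : LogOrder} (hα : α ≠ 0) (p : orderSpace α) :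
    augmentation hα p = (operatorOf hα p).coeff 0 := by
  rw [operatorOf, toOperator_coeff, neg_zero, romanFactorial_zero, Complex.ofReal_one, one_mul,
    augmentation]

theorem operatorOf_harmonic_neg_one {α : LogOrder} (hα : α ≠ 0) :
    operatorOf hα (harmonic α (-1)) = HahnSeries.single 1 1 := by
  ext b
  rw [operatorOf, coords_harmonic, toOperator_coeff]
  by_cases hb : b = 1
  · subst hb
    rw [coeff_single_same, coeff_single_same, romanFactorial_neg_one]
    simp
  · rw [coeff_single_of_ne hb, coeff_single_of_ne, mul_zero]
    intro h
    have := OrderDual.toDual_inj.1 h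
    exact hb (by linarith)

/-! ### The Euler derivation `D d/dD` -/

/-- The Euler derivation `D d/dD` of the field of Artinian operators, `D ^ b ↦ b D ^ b`. -/
def euler : ArtinianOp →+ ArtinianOp where
  toFun f :=
    { coeff := fun b => (b : ℂ) * f.coeff b
      isPWO_support' := f.isPWO_support.mono fun _ hb hz => hb (by simp [hz]) }
  map_zero' := by
    ext b
    simp
  map_add' f g := by
    ext b
    simp [mul_add]

theorem euler_coeff (f : ArtinianOp) (b : ℝ) : (euler f).coeff b = (b : ℂ) * f.coeff b := rfl

theorem support_euler_subset (f : ArtinianOp) : (euler f).support ⊆ f.support :=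
  fun _ hb hz => hb (by rw [euler_coeff, hz, mul_zero])

/-- On a product of monomials of degrees `i + j = b` the factor `b` splits as `i + j`. As `euler`
only shrinks supports, all three coefficients can be summed over the same antidiagonal. -/
theorem euler_mul (f g : ArtinianOp) : euler (f * g) = f * euler g + g * euler f := by
  ext b
  rw [HahnSeries.coeff_add, euler_coeff, coeff_mul, mul_comm g,
    coeff_mul_right' g.isPWO_support (support_euler_subset g),
    coeff_mul_left' f.isPWO_support (support_euler_subset f), Finset.mul_sum,
    ← Finset.sum_add_distrib]
  refine Finset.sum_congr rfl fun ij hij => ?_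
  rw [← (Finset.mem_antidiagonal.1 hij).2.2, euler_coeff, euler_coeff]
  push_cast
  ring

theorem map_zpow_of_leibniz {K : Type*} [Field K] (d : K →+ K)
    (hd : ∀ a b, d (a * b) = a * d b + b * d a) (a : K) (n : ℤ) :
    d (a ^ n) = n * (a ^ (n - 1) * d a) := by
  have h := (Derivation.mk' d.toIntLinearMap hd).leibniz_zpow a n
  rwa [zsmul_eq_mul, smul_eq_mul] at h

theorem euler_zpow (f : ArtinianOp) (n : ℤ) :
    euler (f ^ n) = n * (f ^ (n - 1) * euler f) :=
  map_zpow_of_leibniz euler euler_mul f n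

theorem euler_pow_succ (f : ArtinianOp) (n : ℕ) :
    euler (f ^ (n + 1)) = ((n + 1 : ℕ) : ArtinianOp) * (f ^ n * euler f) := by
  have h := euler_zpow f (n + 1)
  rw [add_sub_cancel_right, zpow_natCast, ← Nat.cast_succ, zpow_natCast, Int.cast_natCast] at h
  exact h

theorem euler_one : euler 1 = 0 := by
  have h := euler_zpow 1 0
  rwa [zpow_zero, Int.cast_zero, zero_mul] at h

theorem coeff_C_mul (r : ℂ) (g : ArtinianOp) (b : ℝ) :
    (HahnSeries.C r * g).coeff b = r * g.coeff b := by
  rw [C_apply, coeff_single_zero_mul]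

theorem euler_single (b : ℝ) (r : ℂ) :
    euler (HahnSeries.single b r) = HahnSeries.C (b : ℂ) * HahnSeries.single b r := by
  ext c
  rw [euler_coeff, coeff_C_mul]
  by_cases hc : c = b
  · rw [hc]
  · rw [coeff_single_of_ne hc, mul_zero, mul_zero]

/-- The factor `D` is supplied by `λ_{-1}^α = D λ_0^α`; it turns `f'` into a derivation that keeps
exponents in place. -/
theorem pincherle_mul_single (f : ArtinianOp) :
    pincherle f * HahnSeries.single 1 1 = euler f := by
  ext b
  have h := coeff_mul_single_add (r := (1 : ℂ)) (x := pincherle f) (a := b - 1) (b := (1 : ℝ))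
  rw [sub_add_cancel, mul_one] at h
  rw [h, euler_coeff]
  change (((b - 1 : ℝ) : ℂ) + 1) * f.coeff (b - 1 + 1) = _
  rw [sub_add_cancel]
  push_cast
  ring

theorem finsum_nat_succ {M : Type*} [AddCommMonoid M] (g : ℕ → M) (h : g 0 = 0) :
    ∑ᶠ n, g n = ∑ᶠ n, g (n + 1) := by
  rw [← finsum_mem_range (f := g) (g := Nat.succ) Nat.succ_injective]
  refine finsum_congr fun n => ?_
  cases n with
  | zero => simp [h]
  | succ n => simp

/-- The chain rule for a power series evaluated at an operator of positive degree. -/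
theorem euler_heval {x : ArtinianOp} (hx : 0 < x.orderTop) (F : PowerSeries ℂ) :
    euler (PowerSeries.heval x F) =
      PowerSeries.heval x (PowerSeries.derivative ℂ F) * euler x := by
  rw [mul_comm, PowerSeries.heval_apply, PowerSeries.heval_apply, ← hsum_smul]
  ext e
  rw [euler_coeff, coeff_hsum, coeff_hsum, mul_finsum' _ _ (finite_co_support _ e)]
  -- The constant term is killed by `euler`, and the shift aligns term `n + 1` of `F` with term `n`
  -- of its derivative.
  rw [finsum_nat_succ]
  · refine finsum_congr fun n => ?_
    rw [SummableFamily.smul_apply, of_symm_smul_of_eq_mul, powerSeriesFamily_of_orderTop_pos hx,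
      powerSeriesFamily_of_orderTop_pos hx, ← C_mul_eq_smul, ← C_mul_eq_smul, coeff_C_mul,
      mul_left_comm (euler x), coeff_C_mul, PowerSeries.coeff_derivative, mul_left_comm (e : ℂ),
      ← euler_coeff, euler_pow_succ, mul_comm (x ^ n),
      ← map_natCast (HahnSeries.C : ℂ →+* ArtinianOp), coeff_C_mul]
    push_cast
    ring
  · rw [powerSeriesFamily_of_orderTop_pos hx, HahnSeries.coeff_smul, smul_eq_mul, mul_left_comm,
      ← euler_coeff, pow_zero, euler_one, HahnSeries.coeff_zero, mul_zero]

/-- This is the absorption identity `(n + 1) (r choose n + 1) = r (r - 1 choose n)`. -/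
theorem derivative_binomialSeries (r : ℂ) :
    PowerSeries.derivative ℂ (PowerSeries.binomialSeries ℂ r) =
      r • PowerSeries.binomialSeries ℂ (r - 1) := by
  ext n
  rw [PowerSeries.coeff_derivative, PowerSeries.binomialSeries_coeff, PowerSeries.coeff_smul,
    PowerSeries.binomialSeries_coeff]
  have h := Ring.choose_smul_choose r (n := n + 1) (k := 1) (by omega)
  simp only [Nat.choose_one_right, Ring.choose_one_right, Nat.cast_one, Nat.add_sub_cancel,
    nsmul_eq_mul] at h
  simp only [smul_eq_mul, mul_one]
  rw [← h]
  push_cast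
  ring

/-! ### Powers of a delta operator -/

variable {f : ArtinianOp}

/-- The series `h(D)` in `f(D) = c D (1 + h(D))`. -/
def deltaTail (f : ArtinianOp) : ArtinianOp :=
  HahnSeries.single (-f.order) (f.leadingCoeff)⁻¹ * f - 1

theorem deltaTail_orderTop_pos (hf : f ≠ 0) : 0 < (deltaTail f).orderTop := by
  have h := unit_aux f (inv_mul_cancel₀ (leadingCoeff_ne_zero.2 hf)) (-f.order)
    (neg_add_cancel f.order)
  rw [deltaTail, ← neg_sub, orderTop_neg]
  exact h

/-- With the binomial sum seen as a power series evaluated at `deltaTail f`, laws of exponents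
reduce to identities between binomial series, because `PowerSeries.heval` is a ring homomorphism. -/
theorem npower_eq (f : ArtinianOp) (n : ℤ) (b : ℝ) :
    npower f n b = HahnSeries.single (b * f.order)
      (Complex.exp ((b : ℂ) * (Complex.log f.leadingCoeff + 2 * Real.pi * Complex.I * n))) *
      PowerSeries.heval (deltaTail f) (PowerSeries.binomialSeries ℂ (b : ℂ)) := rfl

theorem npower_add (f : ArtinianOp) (n : ℤ) (a b : ℝ) :
    npower f n (a + b) = npower f n a * npower f n b := by
  rw [npower_eq, npower_eq, npower_eq, mul_mul_mul_comm, single_mul_single, ← Complex.exp_add,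
    ← map_mul, Complex.ofReal_add, PowerSeries.binomialSeries_add, add_mul, add_mul]

theorem npower_zero (f : ArtinianOp) (n : ℤ) : npower f n 0 = 1 := by
  rw [npower_eq, Complex.ofReal_zero, PowerSeries.binomialSeries_zero, map_one]
  simp

/-- The choice of branch disappears at exponent `1`, since `exp (2 π i n) = 1`. -/
theorem npower_one (hf : f ≠ 0) (n : ℤ) : npower f n 1 = f := by
  have hc : f.leadingCoeff ≠ 0 := leadingCoeff_ne_zero.2 hf
  have h1 : PowerSeries.binomialSeries ℂ ((1 : ℝ) : ℂ) = 1 + PowerSeries.X := by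
    simpa using PowerSeries.binomialSeries_nat (R := ℂ) (A := ℂ) 1
  have h2 : Complex.exp (2 * Real.pi * Complex.I * n) = 1 :=
    Complex.exp_eq_one_iff.2 ⟨n, by ring⟩
  rw [npower_eq, h1, map_add, map_one, PowerSeries.heval_X _ (deltaTail_orderTop_pos hf), deltaTail,
    add_sub_cancel, Complex.ofReal_one, one_mul (_ + _ : ℂ), Complex.exp_add, h2, mul_one,
    Complex.exp_log hc, ← mul_assoc, one_mul, single_mul_single, add_neg_cancel, mul_inv_cancel₀ hc,
    single_zero_one, one_mul]

theorem npower_neg_one (hf : f ≠ 0) (n : ℤ) : npower f n (-1) = f⁻¹ := by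
  refine eq_inv_of_mul_eq_one_left ?_
  have h := npower_add f n (-1) 1
  rw [neg_add_cancel, npower_zero, npower_one hf] at h
  exact h.symm

theorem npower_ne_zero (f : ArtinianOp) (n : ℤ) (b : ℝ) : npower f n b ≠ 0 := by
  intro h
  have h1 := npower_add f n b (-b)
  rw [add_neg_cancel, npower_zero, h, zero_mul] at h1
  exact one_ne_zero h1

/-- The binomial sum is `1` plus terms of positive degree, so only the monomial in front contributes
to the order. -/
theorem order_npower (hf : f ≠ 0) (n : ℤ) (b : ℝ) : (npower f n b).order = b * f.order := by
  have hpos : 0 < (HahnSeries.single (-f.order) (f.leadingCoeff)⁻¹ * f - 1).orderTop :=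
    deltaTail_orderTop_pos hf
  have h := ((orderTop_self_sub_one_pos_iff _).1 (orderTop_hsum_binomialFamily_pos hpos (b : ℂ))).1
  have h0 : (binomialFamily (HahnSeries.single (-f.order) (f.leadingCoeff)⁻¹ * f)
      (b : ℂ)).hsum ≠ 0 := right_ne_zero_of_mul (npower_ne_zero f n b)
  rw [npower, order_mul (single_ne_zero (Complex.exp_ne_zero _)) h0,
    order_single (Complex.exp_ne_zero _)]
  have h1 := order_eq_orderTop_of_ne_zero h0
  rw [h] at h1
  rw [show order _ = (0 : ℝ) from WithTop.coe_injective h1, add_zero]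

theorem heval_smul (x : ArtinianOp) (r : ℂ) (F : PowerSeries ℂ) :
    PowerSeries.heval x (r • F) = HahnSeries.C r * PowerSeries.heval x F := by
  rw [PowerSeries.smul_eq_C_mul, map_mul, PowerSeries.heval_C]
  congr 1
  ext b
  rw [HahnSeries.coeff_smul, ← mul_one (HahnSeries.C r), coeff_C_mul, smul_eq_mul]

theorem euler_npower (hf : f ≠ 0) (n : ℤ) (b : ℝ) :
    euler (npower f n b) = HahnSeries.C (b : ℂ) * (npower f n (b - 1) * euler f) := by
  have hx := deltaTail_orderTop_pos hf
  obtain ⟨G, hG⟩ : ∃ G : ArtinianOp, ∀ b : ℝ, euler (npower f n b) =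
      HahnSeries.C (b : ℂ) * (npower f n (b - 1) * G) := by
    -- The product and chain rules give `b f ^ (b - 1) G` with `G` independent of `b`, so `b = 1`
    -- identifies `G` as `euler f` afterwards. The leading monomial in `G` is kept in the
    -- exponential form of the first power so that it merges with that of `f ^ (b - 1)`.
    refine ⟨HahnSeries.C (f.order : ℂ) * f + HahnSeries.single (1 * f.order) (Complex.exp
      (((1 : ℝ) : ℂ) * (Complex.log f.leadingCoeff + 2 * Real.pi * Complex.I * n))) *
        euler (deltaTail f), fun b => ?_⟩
    have h1 : npower f n b = npower f n (b - 1) * f := by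
      have h := npower_add f n (b - 1) 1
      rwa [sub_add_cancel, npower_one hf] at h
    rw [mul_add, mul_left_comm (npower f n (b - 1)), ← h1, npower_eq f n (b - 1),
      mul_right_comm (HahnSeries.single _ _), ← mul_assoc (HahnSeries.single _ _),
      single_mul_single, ← add_mul,
      ← Complex.exp_add, ← add_mul, ← Complex.ofReal_add, sub_add_cancel, npower_eq,
      euler_mul, euler_single, euler_heval hx, derivative_binomialSeries, heval_smul,
      Complex.ofReal_mul, map_mul, Complex.ofReal_sub, Complex.ofReal_one]
    ring
  have h1 := hG 1
  rw [npower_one hf, sub_self, npower_zero, one_mul, Complex.ofReal_one, map_one, one_mul] at h1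
  rw [hG, h1]

/-! ### Residues -/

theorem coeff_zero_euler (g : ArtinianOp) : (euler g).coeff 0 = 0 := by
  rw [euler_coeff, Complex.ofReal_zero, zero_mul]

/-- The logarithmic derivative of a delta operator has residue `1`. -/
theorem coeff_zero_inv_mul_euler (hf : IsDelta f) : (f⁻¹ * euler f).coeff 0 = 1 := by
  obtain ⟨hf0, hf1⟩ := hf
  have hlc : f.coeff 1 = f.leadingCoeff := by rw [leadingCoeff_eq, hf1]
  have hc : f.leadingCoeff ≠ 0 := leadingCoeff_ne_zero.2 hf0
  have hc1 : (euler f).coeff 1 = f.leadingCoeff := by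
    rw [euler_coeff, hlc, Complex.ofReal_one, one_mul]
  have he0 : euler f ≠ 0 := by
    intro h
    rw [h, HahnSeries.coeff_zero] at hc1
    exact hc hc1.symm
  have ho : (euler f).order = 1 := by
    refine le_antisymm (order_le_of_coeff_ne_zero (by rwa [hc1])) ?_
    rw [← hf1]
    exact order_le_of_coeff_ne_zero fun h => coeff_order_eq_zero.not.2 he0 (by
      rw [euler_coeff, h, mul_zero])
  have hi : f⁻¹.order = -1 := by
    have h := order_mul (inv_ne_zero hf0) hf0
    rw [inv_mul_cancel₀ hf0, order_one, hf1] at h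
    linarith
  have hl : f⁻¹.leadingCoeff * f.leadingCoeff = 1 := by
    rw [← leadingCoeff_mul, inv_mul_cancel₀ hf0, leadingCoeff_one]
  have h := coeff_mul_order_add_order f⁻¹ (euler f)
  rw [leadingCoeff_eq (x := euler f), ho, hi, hc1, hl, neg_add_cancel] at h
  exact h

/-- For `b ≠ 0` the operator is, up to the nonzero scalar `b`, a derivative, and derivatives have no
residue; only the logarithmic derivative survives. -/
theorem coeff_zero_npower_mul_euler (hf : IsDelta f) (n : ℤ) (b : ℝ) :
    (npower f n (b - 1) * euler f).coeff 0 = if b = 0 then 1 else 0 := by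
  split_ifs with hb
  · rw [hb, zero_sub, npower_neg_one hf.1, coeff_zero_inv_mul_euler hf]
  · have h := coeff_zero_euler (npower f n b)
    rw [euler_npower hf.1, coeff_C_mul] at h
    exact (mul_eq_zero.1 h).resolve_left (by exact_mod_cast hb)

theorem coeff_zero_zpow_mul_euler (hf : IsDelta f) (b : ℤ) :
    (f ^ (b - 1) * euler f).coeff 0 = if b = 0 then 1 else 0 := by
  split_ifs with hb
  · rw [hb, zero_sub, zpow_neg_one, coeff_zero_inv_mul_euler hf]
  · have h := coeff_zero_euler (f ^ b)
    rw [euler_zpow, ← map_intCast (HahnSeries.C : ℂ →+* ArtinianOp), coeff_C_mul] at h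
    exact (mul_eq_zero.1 h).resolve_left (by exact_mod_cast hb)

theorem order_zpow (hf : f ≠ 0) (b : ℤ) : (f ^ b).order = b * f.order := by
  have hnat : ∀ m : ℕ, (f ^ m).order = m * f.order := fun m => by
    rw [order_pow, nsmul_eq_mul]
  obtain ⟨m, rfl | rfl⟩ := b.eq_nat_or_neg
  · rw [zpow_natCast, hnat, Int.cast_natCast]
  · have h := order_mul (inv_ne_zero (pow_ne_zero m hf)) (pow_ne_zero m hf)
    rw [inv_mul_cancel₀ (pow_ne_zero m hf), order_one, hnat] at h
    rw [zpow_neg, zpow_natCast, Int.cast_neg, Int.cast_natCast]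
    linarith

/-- An operator is zero if some operator of opposite degree annihilates it under the residue
pairing. -/
theorem eq_zero_of_coeff_zero_mul {g q : ArtinianOp} (hg : g ≠ 0) (ho : g.order = -q.order)
    (h : (g * q).coeff 0 = 0) : q = 0 := by
  have h1 := coeff_mul_order_add_order g q
  rw [ho, neg_add_cancel, h] at h1
  exact leadingCoeff_eq_zero.1 ((mul_eq_zero.1 h1.symm).resolve_left (leadingCoeff_ne_zero.2 hg))

/-! ### Operators with integer exponents -/

/-- Laurent series as Artinian operators. -/
def ofLaurent : HahnSeries ℤ ℂ →+* ArtinianOp :=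
  embDomainRingHom (Int.castAddHom ℝ) Int.cast_injective fun _ _ => Int.cast_le

/-- As the image of a field under a ring homomorphism, operators with integer exponents are closed
under products and all integer powers, including negative ones. -/
theorem isDiscreteOp_iff {g : ArtinianOp} : IsDiscreteOp g ↔ ∃ x, ofLaurent x = g := by
  constructor
  · intro h
    refine ⟨⟨fun k => g.coeff k, fun u => ?_⟩, ?_⟩
    · obtain ⟨m, n, hmn, hle⟩ := g.isPWO_support fun n => ⟨((u n : ℤ) : ℝ), (u n).2⟩
      exact ⟨m, n, hmn, Int.cast_le.1 hle⟩
    · ext b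
      by_cases hb : ∃ k : ℤ, (k : ℝ) = b
      · obtain ⟨k, rfl⟩ := hb
        exact embDomain_coeff (a := k)
      · refine (HahnSeries.embDomain_of_notMem_range fun ⟨k, hk⟩ => hb ⟨k, hk⟩).trans ?_
        by_contra h0
        exact hb (h b (Ne.symm h0))
  · rintro ⟨x, rfl⟩ b hb
    by_contra hc
    refine hb (embDomain_of_notMem_range fun ⟨k, hk⟩ => hc ⟨k, hk⟩)

theorem IsDiscreteOp.mul {g h : ArtinianOp} (hg : IsDiscreteOp g) (hh : IsDiscreteOp h) :
    IsDiscreteOp (g * h) := by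
  obtain ⟨x, rfl⟩ := isDiscreteOp_iff.1 hg
  obtain ⟨y, rfl⟩ := isDiscreteOp_iff.1 hh
  exact isDiscreteOp_iff.2 ⟨x * y, map_mul _ _ _⟩

theorem IsDiscreteOp.zpow {g : ArtinianOp} (hg : IsDiscreteOp g) (k : ℤ) :
    IsDiscreteOp (g ^ k) := by
  obtain ⟨x, rfl⟩ := isDiscreteOp_iff.1 hg
  exact isDiscreteOp_iff.2 ⟨x ^ k, map_zpow₀ _ _ _⟩

theorem IsDiscreteOp.euler {g : ArtinianOp} (hg : IsDiscreteOp g) : IsDiscreteOp (euler g) :=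
  fun b hb => hg b (support_euler_subset g hb)

theorem isDiscreteOp_operatorOf {α : LogOrder} {hα : α ≠ 0} {p : orderSpace α}
    (hp : IsDiscreteSeries hα p) : IsDiscreteOp (operatorOf hα p) := by
  intro b hb
  obtain ⟨k, hk⟩ := hp (OrderDual.toDual (-b)) (right_ne_zero_of_mul hb)
  exact ⟨-k, by rw [Int.cast_neg, hk]; exact neg_neg b⟩

theorem operatorOf_pincherle_act {α : LogOrder} (hα : α ≠ 0) (r : ℂ) (g : ArtinianOp) :
    operatorOf hα (r • act hα (pincherle f) (act hα g (harmonic α (-1)))) =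
      HahnSeries.C r * (g * euler f) := by
  rw [operatorOf_smul, operatorOf_act, operatorOf_act, operatorOf_harmonic_neg_one,
    mul_left_comm, pincherle_mul_single, C_mul_eq_smul]

end LogAlgebra

end

/-! ### The transfer formula, by uniqueness under the residue pairing. -/

theorem mainTheorem7 :
    -- the discrete case
    (∀ f : LogAlgebra.ArtinianOp, LogAlgebra.IsDelta f → LogAlgebra.IsDiscreteOp f →
      ∀ (α : LogAlgebra.LogOrder) (hα : α ≠ 0) (p : ℤ → LogAlgebra.orderSpace α),
      LogAlgebra.IsAssociatedDiscrete f hα p →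
      ∀ a : ℤ, p a = (LogAlgebra.romanFactorial a : ℂ) •
        LogAlgebra.act hα (LogAlgebra.pincherle f)
          (LogAlgebra.act hα (f ^ (-1 - a)) (LogAlgebra.harmonic α (-1)))) ∧
    -- the continuous case
    (∀ f : LogAlgebra.ArtinianOp, LogAlgebra.IsDelta f → ∀ (n : ℤ),
      ∀ (α : LogAlgebra.LogOrder) (hα : α ≠ 0) (p : ℝ → LogAlgebra.orderSpace α),
      LogAlgebra.IsAssociated f n hα p →
      ∀ a : ℝ, p a = (LogAlgebra.romanFactorial a : ℂ) •
        LogAlgebra.act hα (LogAlgebra.pincherle f)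
          (LogAlgebra.act hα (LogAlgebra.npower f n (-1 - a)) (LogAlgebra.harmonic α (-1)))) := by
  constructor
  · intro f hf hfd α hα p hp a
    refine LogAlgebra.operatorOf_injective hα ?_
    rw [LogAlgebra.operatorOf_pincherle_act, ← sub_eq_zero]
    set c : ℂ := (LogAlgebra.romanFactorial a : ℂ)
    set q := LogAlgebra.operatorOf hα (p a) - HahnSeries.C c * (f ^ (-1 - a) * LogAlgebra.euler f)
      with hq
    by_contra hne
    have hqd : LogAlgebra.IsDiscreteOp q := by
      intro b hb
      by_contra hb'
      refine hb ?_
      have h1 : (LogAlgebra.operatorOf hα (p a)).coeff b = 0 := by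
        by_contra h
        exact hb' (LogAlgebra.isDiscreteOp_operatorOf (hp.1 a) b h)
      have h2 : (f ^ (-1 - a) * LogAlgebra.euler f).coeff b = 0 := by
        by_contra h
        exact hb' ((hfd.zpow _).mul hfd.euler b h)
      rw [hq, HahnSeries.coeff_sub, LogAlgebra.coeff_C_mul, h1, h2, mul_zero, sub_zero]
    -- Integrality of the order makes `-k` an admissible test exponent: `f ^ (-k)` has degree
    -- opposite to that of `q`.
    obtain ⟨k, hk⟩ := hqd q.order (HahnSeries.coeff_order_eq_zero.not.2 hne)
    refine hne (LogAlgebra.eq_zero_of_coeff_zero_mul (zpow_ne_zero (-k) hf.1) ?_ ?_)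
    · rw [LogAlgebra.order_zpow hf.1, hf.2, mul_one, Int.cast_neg, hk]
    · have h := hp.2 a (-k)
      rw [LogAlgebra.augmentation_eq_coeff, LogAlgebra.operatorOf_act] at h
      have e : -k + (-1 - a) = -k - a - 1 := by ring
      rw [hq, mul_sub, mul_left_comm, ← mul_assoc (f ^ (-k)), ← zpow_add₀ hf.1,
        HahnSeries.coeff_sub, LogAlgebra.coeff_C_mul, h, e,
        LogAlgebra.coeff_zero_zpow_mul_euler hf]
      by_cases hak : a = -k
      · rw [if_pos hak, if_pos (by rw [hak, sub_self]), mul_one, sub_self]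
      · rw [if_neg hak, if_neg (fun h => hak (sub_eq_zero.1 h).symm), mul_zero, sub_self]
  · intro f hf n α hα p hp a
    refine LogAlgebra.operatorOf_injective hα ?_
    rw [LogAlgebra.operatorOf_pincherle_act, ← sub_eq_zero]
    set c : ℂ := (LogAlgebra.romanFactorial a : ℂ)
    set q := LogAlgebra.operatorOf hα (p a) -
      HahnSeries.C c * (LogAlgebra.npower f n (-1 - a) * LogAlgebra.euler f) with hq
    -- Real exponents reach every degree, so no integrality argument is needed here.
    refine LogAlgebra.eq_zero_of_coeff_zero_mul (LogAlgebra.npower_ne_zero f n (-q.order)) ?_ ?_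
    · rw [LogAlgebra.order_npower hf.1, hf.2, mul_one]
    -- The pairing with `q` vanishes for every exponent; the particular value mattered only for the
    -- degree.
    · generalize -q.order = b
      have h := hp a b
      rw [LogAlgebra.augmentation_eq_coeff, LogAlgebra.operatorOf_act] at h
      have e : b + (-1 - a) = b - a - 1 := by ring
      rw [hq, mul_sub, mul_left_comm, ← mul_assoc (LogAlgebra.npower f n b),
        ← LogAlgebra.npower_add, HahnSeries.coeff_sub, LogAlgebra.coeff_C_mul, h, e,
        LogAlgebra.coeff_zero_npower_mul_euler hf]
      by_cases hab : a = b
      · rw [if_pos hab, if_pos (by rw [hab, sub_self]), mul_one, sub_self]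
      · rw [if_neg hab, if_neg (fun h => hab (sub_eq_zero.1 h).symm), mul_zero, sub_self]
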